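/- Let $m\ge 1$ and let $\Gamma\subset\mathbb R^m\times\mathbb R$ be a lattice whose coordinate projections $p_1:\mathbb R^m\times\mathbb R\to\mathbb R^m$ and $p_2:\mathbb R^m\times\mathbb R\to\mathbb R$ are both injective on $\Gamma$, with $p_1(\Gamma)$ dense in $\mathbb R^m$ and $p_2(\Gamma)$ dense in $\mathbb R$. Let $\Omega\subset\mathbb R$ be a compact interval with non-empty interior, symmetric around the origin, and let $\Lambda(\Omega)=\{p_1(\gamma):\gamma\in\Gamma,\ p_2(\gamma)\in\Omega\}$ be the corresponding simple model set. Write $T_\lambda f(t)=f(t-\lambda)$, $\widehat f(\omega)=\int f(t)e^{-2\pi i t\cdot\omega}\,dt$, and let $W(L^2,\ell^1)$ be the space of measurable $f:\mathbb R^m\to\mathbb C$ with $\sum_{n\in\mathbb Z^m}\|f\,\mathbf 1_{[0,1]^m+n}\|_2<\infty$. A family $(u_i)$ in $L^2(\mathbb R^m)$ is a Bessel sequence with bound $B$ if $\sum_i|\langle f,u_i\rangle|^2\le B\|f\|_2^2$ for all $f\in L^2(\mathbb R^m)$. Let $\mathcal K$ be a countable set and $g_k\in W(L^2,\ell^1)$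 for $k\in\mathcal K$, and suppose that $\{T_\lambda g_k:k\in\mathcal K,\lambda\in\Lambda(\Omega)\}$ is a Bessel sequence with bound $B_g$. (a) Let $\psi:\mathbb R\to\mathbb R$ be a non-negative smooth function with support in $\Omega$, and put $w_\psi(\lambda)=\psi(p_2(\gamma))$ for $\lambda=p_1(\gamma)\in\Lambda(\Omega)$ with $\gamma\in\Gamma$. Then $\{w_\psi(\lambda)T_\lambda g_k:k\in\mathcal K,\lambda\in\Lambda(\Omega)\}$ is a Bessel sequence with bound $\|\psi\|_\infty^2B_g$, and $$\mathrm{vol}(\Gamma)^{-1}\,\widehat{\psi^2}(0)\sum_{k\in\mathcal K}|\widehat g_k(t)|^2\le\|\psi\|_\infty^2B_g\quad\text{for a.e. }t\in\mathbb R^m,$$ where $\widehat{\psi^2}(0)=\int_{\mathbb R}\psi(s)^2\,ds$ and $\mathrm{vol}(\Gamma)$ is the covolume of $\Gamma$. (b) In particular, the density $D(\Lambda(\Omega))=\lim_{R\to\infty}R^{-m}\,\#\bigl(\Lambda(\Omega)\cap(x+R[0,1]^m)\bigr)$ exists, with the same value $\mathrm{vol}(\Gamma)^{-1}|\Omega|$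 for every $x\in\mathbb R^m$, and $$D(\Lambda(\Omega))\sum_{k\in\mathcal K}|\widehat g_k(t)|^2\le B_g\quad\text{for a.e. }t\in\mathbb R^m.$$ -/

import Mathlib

open MeasureTheory Filter Topology
open scoped NNReal ENNReal FourierTransform ContDiff ComplexConjugate

namespace ModelSet

/-- The cube `B(x, R) = R [0,1]^m + x` in `ℝ^m`. -/
def cube {m : ℕ} (x : EuclideanSpace ℝ (Fin m)) (R : ℝ) : Set (EuclideanSpace ℝ (Fin m)) :=
  {y | ∀ i, y i ∈ Set.Icc (x i) (x i + R)}

/-- The point of `ℝ^m` with integer coordinates `k`. -/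
noncomputable def intPoint {m : ℕ} (k : Fin m → ℤ) : EuclideanSpace ℝ (Fin m) :=
  WithLp.toLp 2 fun i => (k i : ℝ)

/-- The Wiener amalgam norm `‖f‖_{p,1} = ∑_{k ∈ ℤ^m} ‖f 𝟙_{[0,1]^m + k}‖_p`. -/
noncomputable def wienerNorm {m : ℕ} (p : ℝ≥0∞) (f : EuclideanSpace ℝ (Fin m) → ℂ) : ℝ≥0∞ :=
  ∑' k : Fin m → ℤ, eLpNorm ((cube (intPoint k) 1).indicator f) p volume

/-- Membership in the Wiener amalgam space `W(L^p, ℓ^1)`. -/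
def MemWiener {m : ℕ} (p : ℝ≥0∞) (f : EuclideanSpace ℝ (Fin m) → ℂ) : Prop :=
  AEStronglyMeasurable f volume ∧ wienerNorm p f < (⊤ : ℝ≥0∞)

/-- The translation operator `T_x f (t) = f (t - x)`. -/
def translate {m : ℕ} (x : EuclideanSpace ℝ (Fin m)) (f : EuclideanSpace ℝ (Fin m) → ℂ) :
    EuclideanSpace ℝ (Fin m) → ℂ :=
  fun t => f (t - x)

/-- The family `u` of functions in `L²(ℝ^m)` is a Bessel sequence with upper bound `B`:
`∑_i |⟨f, u_i⟩|² ≤ B ‖f‖₂²` for every `f ∈ L²(ℝ^m)`, where `⟨f, h⟩ = ∫ f h̄`. -/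
def IsBessel {m : ℕ} {ι : Type*} (u : ι → EuclideanSpace ℝ (Fin m) → ℂ) (B : ℝ≥0) : Prop :=
  (∀ i, MemLp (u i) 2 volume) ∧
    ∀ f : EuclideanSpace ℝ (Fin m) → ℂ, MemLp f 2 volume →
      ∑' i, ‖∫ t, f t * conj (u i t)‖ₑ ^ 2 ≤ (B : ℝ≥0∞) * eLpNorm f 2 volume ^ 2

/-- The requirements on the projections of a lattice `Γ ⊂ ℝ^m × ℝ` defining simple model sets:
both `p₁` and `p₂` are injective on `Γ` and have dense image. -/
structure IsCutProject {m : ℕ} (Γ : Submodule ℤ (EuclideanSpace ℝ (Fin m) × ℝ)) : Prop where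
  injOn_fst : Set.InjOn Prod.fst (Γ : Set (EuclideanSpace ℝ (Fin m) × ℝ))
  dense_fst : Dense (Prod.fst '' (Γ : Set (EuclideanSpace ℝ (Fin m) × ℝ)))
  injOn_snd : Set.InjOn Prod.snd (Γ : Set (EuclideanSpace ℝ (Fin m) × ℝ))
  dense_snd : Dense (Prod.snd '' (Γ : Set (EuclideanSpace ℝ (Fin m) × ℝ)))

/-- A window in `ℝ` that is an interval. -/
structure IsIntervalWindow (Ω : Set ℝ) : Prop where
  nonempty : Ω.Nonempty
  isCompact : IsCompact Ω
  closure_interior : closure (interior Ω) = Ω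
  volume_frontier : volume (frontier Ω) = 0
  ordConnected : Ω.OrdConnected

/-- The model set `Λ(Ω) = {p₁(γ) : γ ∈ Γ, p₂(γ) ∈ Ω}`. -/
def modelSet {m : ℕ} (Γ : Submodule ℤ (EuclideanSpace ℝ (Fin m) × ℝ)) (Ω : Set ℝ) :
    Set (EuclideanSpace ℝ (Fin m)) :=
  {x | ∃ γ ∈ Γ, γ.2 ∈ Ω ∧ γ.1 = x}

/-- `Λ` has density `D`: for every `x`, `#(Λ ∩ B(x, R)) / R^m → D` as `R → ∞`; the sets counted are
required to be finite. -/
def HasDensity {m : ℕ} (Λ : Set (EuclideanSpace ℝ (Fin m))) (D : ℝ) : Prop :=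
  ∀ x : EuclideanSpace ℝ (Fin m),
    (∀ R : ℝ, (Λ ∩ cube x R).Finite) ∧
      Tendsto (fun R : ℝ => ((Λ ∩ cube x R).ncard : ℝ) / R ^ m) atTop (𝓝 D)

/-- `ψ ∈ C₀^∞(Ω)`: a smooth real-valued function on `ℝ` with support in `Ω`. -/
def IsSmoothOn (Ω : Set ℝ) (ψ : ℝ → ℝ) : Prop :=
  ContDiff ℝ ∞ ψ ∧ tsupport ψ ⊆ Ω

/-- The sup norm `‖ψ‖_∞` (of a bounded function). -/
noncomputable def supNorm (ψ : ℝ → ℝ) : ℝ≥0 := ⨆ s, ‖ψ s‖₊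

open Classical in
/-- The weight `w_ψ(λ) = ψ(p₂(γ))` for `λ = p₁(γ) ∈ Λ(Ω)`, and `w_ψ(λ) = 0` for `λ ∉ Λ(Ω)`. -/
noncomputable def weight {m : ℕ} (Γ : Submodule ℤ (EuclideanSpace ℝ (Fin m) × ℝ)) (Ω : Set ℝ)
    (ψ : ℝ → ℝ) (x : EuclideanSpace ℝ (Fin m)) : ℝ :=
  if h : ∃ γ ∈ Γ, γ.2 ∈ Ω ∧ γ.1 = x then ψ h.choose.2 else 0

/-- As `p₁` is injective on `Γ`, the choice in the definition of the weight is immaterial. -/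
theorem weight_fst {m : ℕ} {Γ : Submodule ℤ (EuclideanSpace ℝ (Fin m) × ℝ)}
    (hΓ : IsCutProject Γ) {Ω : Set ℝ} (ψ : ℝ → ℝ) {γ : EuclideanSpace ℝ (Fin m) × ℝ}
    (hγ : γ ∈ Γ) (hΩ : γ.2 ∈ Ω) : weight Γ Ω ψ γ.1 = ψ γ.2 := by
  have h : ∃ γ' ∈ Γ, γ'.2 ∈ Ω ∧ γ'.1 = γ.1 := ⟨γ, hγ, hΩ, rfl⟩
  have e : h.choose = γ := hΓ.injOn_fst h.choose_spec.1 hγ h.choose_spec.2.2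
  rw [weight, dif_pos h, e]

end ModelSet
/-!
By invariance under `Γ`, the measure of `A` is the integral of `v ↦ #{γ ∈ Γ : γ + v ∈ A}` over a
fundamental domain. As `p₂(Γ)` is dense, `Γ` plus the product of a large ball in `ℝ^m` and an
arbitrarily small interval is everything, so these counts, for `A` a cube times the window, vary
with `v` only through a layer of bounded width around the cube and an arbitrarily thin layer around
the frontier of `Ω`. Hence the density of the model set is `vol(Γ)⁻¹ |Ω|`.

For the spectral bound, test the Bessel inequality on a plane wave of frequency `ξ` cut off to a
large cube: each translate `T_λ g_k` with `λ` well inside contributes `|ĝ_k(ξ)|²` up to the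
`L¹`-tail of `g_k`. Dividing by the volume of the cube turns the number of such `λ` into the
density. The weighted bound follows, since `∫ ψ² ≤ ‖ψ‖_∞² |Ω|`.
-/

namespace ModelSet

section LatticePoints

open scoped Pointwise

theorem measure_eq_lintegral_encard {G α : Type*} [AddGroup G] [AddAction G α] [Countable G]
    [MeasurableSpace α] [MeasurableConstVAdd G α] {μ : Measure α} [VAddInvariantMeasure G α μ]
    {F A : Set α} (hF : IsAddFundamentalDomain G F μ) (hA : NullMeasurableSet A μ) :
    μ A = ∫⁻ v in F, ({g : G | g +ᵥ v ∈ A}.encard : ℝ≥0∞) ∂μ := by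
  have hmeas : ∀ g : G, AEMeasurable (fun v => A.indicator 1 (g +ᵥ v) : α → ℝ≥0∞)
      (μ.restrict F) := fun g =>
    ((aemeasurable_one.indicator₀ hA).comp_quasiMeasurePreserving
      (measurePreserving_vadd g μ).quasiMeasurePreserving).restrict
  rw [← lintegral_indicator_one₀ hA, hF.lintegral_eq_tsum'', ← lintegral_tsum hmeas]
  refine lintegral_congr fun v => ?_
  rw [← ENNReal.tsum_set_one, tsum_subtype _ fun _ => (1 : ℝ≥0∞)]
  rfl

variable {E : Type*} [NormedAddCommGroup E] [NormedSpace ℝ E] [FiniteDimensional ℝ E]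
  {Γ : Submodule ℤ E} [DiscreteTopology Γ] [IsZLattice ℝ Γ]

section Covolume

variable [MeasurableSpace E] [BorelSpace E] {μ : Measure E} [μ.IsAddHaarMeasure]

theorem exists_fundamentalDomain_measure_eq_lintegral_encard (Γ : Submodule ℤ E)
    [DiscreteTopology Γ] [IsZLattice ℝ Γ] (μ : Measure E) [μ.IsAddHaarMeasure] :
    ∃ F : Set E, μ F = ENNReal.ofReal (ZLattice.covolume Γ μ) ∧
      ∀ A, NullMeasurableSet A μ → μ A = ∫⁻ v in F, ({γ : Γ | γ + v ∈ A}.encard : ℝ≥0∞) ∂μ := by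
  have : MeasurableConstVAdd Γ E := inferInstanceAs (MeasurableConstVAdd Γ.toAddSubgroup E)
  have : VAddInvariantMeasure Γ E μ := inferInstanceAs (VAddInvariantMeasure Γ.toAddSubgroup E μ)
  let b := Module.Free.chooseBasis ℤ Γ
  have hF := ZLattice.isAddFundamentalDomain b μ
  refine ⟨_, ?_, fun A hA => measure_eq_lintegral_encard hF hA⟩
  rw [ZLattice.covolume_eq_measure_fundamentalDomain Γ μ hF,
    ofReal_measureReal (ZSpan.fundamentalDomain_isBounded _).measure_lt_top.ne]

theorem measure_le_covolume_mul_encard {A B U : Set E} (hU : (Γ : Set E) + U = Set.univ)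
    (hA : NullMeasurableSet A μ) (hAB : A - U ⊆ B) :
    μ A ≤ ENNReal.ofReal (ZLattice.covolume Γ μ) * ((Γ : Set E) ∩ B).encard := by
  obtain ⟨F, hF, haverage⟩ := exists_fundamentalDomain_measure_eq_lintegral_encard Γ μ
  rw [haverage A hA, mul_comm, ← hF, ← setLIntegral_const]
  refine lintegral_mono fun v => ENat.toENNReal_le.2 ?_
  obtain ⟨δ, hδ, u, hu, rfl⟩ := hU.ge (Set.mem_univ v)
  refine Set.encard_le_encard_of_injOn (f := fun γ : Γ => (γ : E) + δ) (fun γ hγ => ?_)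
    ((add_left_injective δ).comp Subtype.val_injective).injOn
  exact ⟨Γ.add_mem γ.2 hδ, hAB ⟨_, hγ, u, hu, by simp [← add_assoc]⟩⟩

theorem covolume_mul_encard_le_measure {A B U : Set E} (hU : (Γ : Set E) + U = Set.univ)
    (hB : NullMeasurableSet B μ) (hAB : A + U ⊆ B) :
    ENNReal.ofReal (ZLattice.covolume Γ μ) * ((Γ : Set E) ∩ A).encard ≤ μ B := by
  obtain ⟨F, hF, haverage⟩ := exists_fundamentalDomain_measure_eq_lintegral_encard Γ μ
  rw [haverage B hB, mul_comm, ← hF, ← setLIntegral_const]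
  refine lintegral_mono fun v => ENat.toENNReal_le.2 ?_
  obtain ⟨δ, hδ, u, hu, rfl⟩ := hU.ge (Set.mem_univ v)
  rw [← Subtype.image_preimage_coe, Subtype.val_injective.encard_image]
  refine Set.encard_le_encard_of_injOn (f := fun γ : Γ => γ - ⟨δ, hδ⟩) (fun γ hγ => ?_)
    (sub_left_injective (b := (⟨δ, hδ⟩ : Γ))).injOn
  exact hAB ⟨γ, hγ, u, hu, by simp [← add_assoc]⟩

end Covolume

theorem exists_add_eq_univ_of_iUnion_add_eq_univ {U : ℕ → Set E} (hopen : ∀ n, IsOpen (U n))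
    (hmono : Monotone U) (hU : (Γ : Set E) + ⋃ n, U n = Set.univ) :
    ∃ n, (Γ : Set E) + U n = Set.univ := by
  let π : E → E ⧸ Γ.toAddSubgroup := QuotientAddGroup.mk
  have hπ : ∀ {v w : E}, π v = π w ↔ -v + w ∈ Γ := QuotientAddGroup.eq
  have hcompact : IsCompact (Set.range π) :=
    IsZLattice.isCompact_range_of_periodic Γ π continuous_quot_mk fun z w hw =>
      (hπ.2 (by simpa using hw)).symm
  have hcover : Set.range π ⊆ ⋃ n, π '' U n := by
    rintro _ ⟨v, rfl⟩
    obtain ⟨γ, hγ, u, hu, rfl⟩ := hU.ge (Set.mem_univ v)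
    obtain ⟨n, hn⟩ := Set.mem_iUnion.1 hu
    exact Set.mem_iUnion.2 ⟨n, u, hn, hπ.2 (by simpa using hγ)⟩
  obtain ⟨n, hn⟩ := hcompact.elim_directed_cover _
    (fun n => QuotientAddGroup.isOpenMap_coe _ (hopen n)) hcover
    (Monotone.directed_le fun i j hij => Set.image_mono (hmono hij))
  refine ⟨n, Set.eq_univ_of_forall fun v => ?_⟩
  obtain ⟨u, hu, huv⟩ := hn ⟨v, rfl⟩
  exact ⟨-u + v, hπ.1 huv, u, hu, by simp⟩

theorem exists_add_ball_prod_ball_eq_univ {E H : Type*} [NormedAddCommGroup E] [NormedSpace ℝ E]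
    [FiniteDimensional ℝ E] [NormedAddCommGroup H] [NormedSpace ℝ H] [FiniteDimensional ℝ H]
    {Γ : Submodule ℤ (E × H)} [DiscreteTopology Γ] [IsZLattice ℝ Γ]
    (hdense : Dense (Prod.snd '' (Γ : Set (E × H)))) {ε : ℝ} (hε : 0 < ε) :
    ∃ C : ℝ, (Γ : Set (E × H)) + Metric.ball 0 C ×ˢ Metric.ball 0 ε = Set.univ := by
  obtain ⟨n, hn⟩ := exists_add_eq_univ_of_iUnion_add_eq_univ (Γ := Γ)
    (U := fun n : ℕ => Metric.ball 0 n ×ˢ Metric.ball 0 ε)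
    (fun n => Metric.isOpen_ball.prod Metric.isOpen_ball)
    (fun i j hij => Set.prod_mono_left (Metric.ball_subset_ball (Nat.cast_le.2 hij))) <| by
      refine Set.eq_univ_of_forall fun v => ?_
      obtain ⟨_, ⟨γ, hγ, rfl⟩, hvγ⟩ := hdense.exists_dist_lt v.2 hε
      obtain ⟨n, hn⟩ := exists_nat_gt ‖v.1 - γ.1‖
      refine ⟨γ, hγ, v - γ, Set.mem_iUnion.2 ⟨n, ?_⟩, add_sub_cancel γ v⟩
      exact ⟨by simpa using hn, by simpa [dist_eq_norm] using hvγ⟩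
  exact ⟨n, hn⟩

end LatticePoints

section Frontier

theorem mem_iff_mem_of_dist_lt_of_notMem_thickening_frontier {H : Type*}
    [NormedAddCommGroup H] [NormedSpace ℝ H] {Ω : Set H} {x y : H} {ε : ℝ} (hxy : dist y x < ε)
    (hx : x ∉ Metric.thickening ε (frontier Ω)) : x ∈ Ω ↔ y ∈ Ω := by
  have hball : IsPreconnected (Metric.ball x ε) := (convex_ball x ε).isPreconnected
  have hdisj : Disjoint (Metric.ball x ε) (frontier Ω) := by
    refine Set.disjoint_left.2 fun z hz hzΩ => hx ?_
    exact Metric.mem_thickening_iff.2 ⟨z, hzΩ, Metric.mem_ball'.1 hz⟩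
  have hcover : Metric.ball x ε ⊆ interior Ω ∪ interior Ωᶜ := by
    rw [← compl_frontier_eq_union_interior]
    exact hdisj.subset_compl_right
  have hyball : y ∈ Metric.ball x ε := hxy
  have hxball : x ∈ Metric.ball x ε := Metric.mem_ball_self (dist_nonneg.trans_lt hxy)
  rcases hball.subset_or_subset isOpen_interior isOpen_interior
    (disjoint_compl_right.mono interior_subset interior_subset) hcover with hin | hout
  · exact iff_of_true (interior_subset (hin hxball)) (interior_subset (hin hyball))
  · exact iff_of_false (interior_subset (hout hxball)) (interior_subset (hout hyball))

theorem exists_measure_thickening_frontier_le {X : Type*} [PseudoMetricSpace X] [ProperSpace X]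
    [MeasurableSpace X] [BorelSpace X] {μ : Measure X} [IsFiniteMeasureOnCompacts μ]
    {Ω : Set X} (hΩ : Bornology.IsBounded Ω) (hΩ₀ : μ (frontier Ω) = 0) {δ : ℝ≥0∞} (hδ : 0 < δ) :
    ∃ ε > 0, μ (Metric.thickening ε (frontier Ω)) ≤ δ := by
  have hbdd : Bornology.IsBounded (frontier Ω) := hΩ.closure.subset frontier_subset_closure
  have hlim := tendsto_measure_thickening_of_isClosed (μ := μ)
    ⟨1, one_pos, hbdd.thickening.measure_lt_top.ne⟩ (isClosed_frontier (s := Ω))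
  rw [hΩ₀] at hlim
  obtain ⟨ε, hle, hε⟩ := ((hlim.eventually_le_const hδ).and self_mem_nhdsWithin).exists
  exact ⟨ε, hε, hle⟩

end Frontier

section Cube

variable {m : ℕ}

/-- The point of `ℝ^m` all of whose coordinates are `r`: subtracting it from `x` and adding `2 * r`
to `R` enlarges `cube x R` by `r` in every direction. -/
noncomputable def diagPoint (m : ℕ) (r : ℝ) : EuclideanSpace ℝ (Fin m) :=
  WithLp.toLp 2 fun _ => r

@[simp]
theorem diagPoint_apply (r : ℝ) (i : Fin m) : diagPoint m r i = r := rfl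

theorem cube_eq_preimage (x : EuclideanSpace ℝ (Fin m)) (R : ℝ) :
    cube x R = WithLp.ofLp ⁻¹' Set.Icc (WithLp.ofLp x) (fun i => x i + R) := by
  ext y
  simp [cube, Pi.le_def, forall_and]

theorem measurableSet_cube (x : EuclideanSpace ℝ (Fin m)) (R : ℝ) :
    MeasurableSet (cube x R) := by
  rw [cube_eq_preimage]
  exact (PiLp.volume_preserving_ofLp (Fin m)).measurable measurableSet_Icc

theorem volume_cube (x : EuclideanSpace ℝ (Fin m)) (R : ℝ) :
    volume (cube x R) = ENNReal.ofReal R ^ m := by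
  rw [cube_eq_preimage, (PiLp.volume_preserving_ofLp (Fin m)).measure_preimage
    measurableSet_Icc.nullMeasurableSet, Real.volume_Icc_pi]
  simp

theorem isBounded_cube (x : EuclideanSpace ℝ (Fin m)) (R : ℝ) :
    Bornology.IsBounded (cube x R) := by
  rw [cube_eq_preimage]
  exact (PiLp.antilipschitzWith_ofLp 2 (fun _ : Fin m => ℝ)).isBounded_preimage
    (Metric.isBounded_Icc _ _)

theorem mem_cube_floor (t : EuclideanSpace ℝ (Fin m)) :
    t ∈ cube (intPoint fun i => ⌊t i⌋) 1 :=
  fun _ => ⟨Int.floor_le _, (Int.lt_floor_add_one _).le⟩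

theorem closedBall_subset_cube {x y : EuclideanSpace ℝ (Fin m)} {r R : ℝ} (hy : y ∈ cube x R) :
    Metric.closedBall y r ⊆ cube (x - diagPoint m r) (R + 2 * r) := by
  intro z hz i
  have hzy : |z i - y i| ≤ r :=
    (PiLp.norm_apply_le (z - y) i).trans (mem_closedBall_iff_norm.1 hz)
  obtain ⟨hlow, hupp⟩ := abs_le.1 hzy
  obtain ⟨hxy, hyx⟩ := hy i
  simp only [PiLp.sub_apply, diagPoint_apply, Set.mem_Icc]
  constructor <;> linarith

end Cube

theorem tendsto_ofReal_add_const_pow_div (m : ℕ) (C : ℝ) :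
    Tendsto (fun R : ℝ => ENNReal.ofReal (R + C) ^ m / ENNReal.ofReal R ^ m) atTop (𝓝 1) := by
  have hlim : Tendsto (fun R : ℝ => 1 + C / R) atTop (𝓝 1) := by
    simpa using tendsto_const_nhds.add (tendsto_id.const_div_atTop C)
  have hpow := (ENNReal.continuous_pow m).continuousAt.tendsto.comp
    (ENNReal.tendsto_ofReal hlim)
  rw [ENNReal.ofReal_one, one_pow] at hpow
  refine hpow.congr' ?_
  filter_upwards [eventually_gt_atTop 0] with R hR
  rw [div_eq_mul_inv, ENNReal.inv_pow, ← mul_pow, ← div_eq_mul_inv,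
    ← ENNReal.ofReal_div_of_pos hR, add_div, div_self hR.ne']
  rfl

theorem tendsto_div_ofReal_pow_of_forall_exists_bounds {m : ℕ} {f : ℝ → ℝ≥0∞} {L : ℝ≥0∞}
    (h : ∀ δ : ℝ≥0, 0 < δ → ∃ C : ℝ, ∀ R,
      ENNReal.ofReal (R - C) ^ m * (L - δ) ≤ f R ∧ f R ≤ ENNReal.ofReal (R + C) ^ m * (L + δ)) :
    Tendsto (fun R => f R / ENNReal.ofReal R ^ m) atTop (𝓝 L) := by
  have hratio : ∀ C (c : ℝ≥0∞), Tendsto (fun R : ℝ =>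
      ENNReal.ofReal (R + C) ^ m * c / ENNReal.ofReal R ^ m) atTop (𝓝 c) := fun C c => by
    simpa only [one_mul, ENNReal.mul_div_right_comm] using
      ENNReal.Tendsto.mul_const (tendsto_ofReal_add_const_pow_div m C) (Or.inl one_ne_zero)
  refine tendsto_order.2 ⟨fun a ha => ?_, fun a ha => ?_⟩
  · obtain ⟨δ, hδ, haδ⟩ := ENNReal.lt_iff_exists_add_pos_lt.1 ha
    obtain ⟨C, hC⟩ := h δ hδ
    filter_upwards [(hratio (-C) (L - δ)).eventually_const_lt (lt_tsub_iff_right.2 haδ)] with R hR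
    exact hR.trans_le (ENNReal.div_le_div_right (hC R).1 _)
  · obtain ⟨δ, hδ, haδ⟩ := ENNReal.lt_iff_exists_add_pos_lt.1 ha
    obtain ⟨C, hC⟩ := h δ hδ
    filter_upwards [(hratio C (L + δ)).eventually_lt_const haδ] with R hR
    exact (ENNReal.div_le_div_right (hC R).2 _).trans_lt hR

section Density

open scoped Pointwise

variable {m : ℕ} {Γ : Submodule ℤ (EuclideanSpace ℝ (Fin m) × ℝ)} {Ω : Set ℝ}

instance isAddHaarMeasure_volume_prod :
    (volume : Measure (EuclideanSpace ℝ (Fin m) × ℝ)).IsAddHaarMeasure :=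
  inferInstanceAs ((volume : Measure (EuclideanSpace ℝ (Fin m))).prod
    (volume : Measure ℝ)).IsAddHaarMeasure

theorem volume_cube_prod (x : EuclideanSpace ℝ (Fin m)) (R : ℝ) (Ω : Set ℝ) :
    volume (cube x R ×ˢ Ω) = ENNReal.ofReal R ^ m * volume Ω := by
  rw [Measure.volume_eq_prod, Measure.prod_prod, volume_cube]

theorem modelSet_inter_eq_image_fst (Γ : Submodule ℤ (EuclideanSpace ℝ (Fin m) × ℝ)) (Ω : Set ℝ)
    (Q : Set (EuclideanSpace ℝ (Fin m))) :
    modelSet Γ Ω ∩ Q = Prod.fst '' ((Γ : Set (EuclideanSpace ℝ (Fin m) × ℝ)) ∩ Q ×ˢ Ω) := by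
  ext y
  constructor
  · rintro ⟨⟨γ, hγ, hΩ, rfl⟩, hy⟩
    exact ⟨γ, ⟨hγ, hy, hΩ⟩, rfl⟩
  · rintro ⟨γ, ⟨hγ, hy, hΩ⟩, rfl⟩
    exact ⟨⟨γ, hγ, hΩ, rfl⟩, hy⟩

theorem finite_modelSet_inter [DiscreteTopology Γ] (hΩ : Bornology.IsBounded Ω)
    {Q : Set (EuclideanSpace ℝ (Fin m))} (hQ : Bornology.IsBounded Q) :
    (modelSet Γ Ω ∩ Q).Finite := by
  have hclosed : IsClosed (Γ : Set (EuclideanSpace ℝ (Fin m) × ℝ)) :=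
    AddSubgroup.isClosed_of_discrete (H := Γ.toAddSubgroup)
  rw [modelSet_inter_eq_image_fst, Set.inter_comm]
  exact (Metric.finite_isBounded_inter_isClosed DiscreteTopology.isDiscrete (hQ.prod hΩ)
    hclosed).image _

theorem encard_modelSet_inter
    (hinj : Set.InjOn Prod.fst (Γ : Set (EuclideanSpace ℝ (Fin m) × ℝ))) (Ω : Set ℝ)
    (Q : Set (EuclideanSpace ℝ (Fin m))) :
    (modelSet Γ Ω ∩ Q).encard = ((Γ : Set (EuclideanSpace ℝ (Fin m) × ℝ)) ∩ Q ×ˢ Ω).encard := by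
  rw [modelSet_inter_eq_image_fst, (hinj.mono Set.inter_subset_left).encard_image]

variable [DiscreteTopology Γ] [IsZLattice ℝ Γ]

theorem exists_bounds_covolume_mul_encard_modelSet_inter_cube
    (hinj : Set.InjOn Prod.fst (Γ : Set (EuclideanSpace ℝ (Fin m) × ℝ)))
    (hdense : Dense (Prod.snd '' (Γ : Set (EuclideanSpace ℝ (Fin m) × ℝ))))
    (hΩ : Bornology.IsBounded Ω) (hΩ₀ : volume (frontier Ω) = 0) {δ : ℝ≥0∞} (hδ : 0 < δ) :
    ∃ C : ℝ, ∀ (x : EuclideanSpace ℝ (Fin m)) (R : ℝ),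
      ENNReal.ofReal (R - C) ^ m * (volume Ω - δ) ≤
          ENNReal.ofReal (ZLattice.covolume Γ) * (modelSet Γ Ω ∩ cube x R).encard ∧
        ENNReal.ofReal (ZLattice.covolume Γ) * (modelSet Γ Ω ∩ cube x R).encard ≤
          ENNReal.ofReal (R + C) ^ m * (volume Ω + δ) := by
  obtain ⟨ε, hε, hvol⟩ := exists_measure_thickening_frontier_le hΩ hΩ₀ hδ
  obtain ⟨C, hU⟩ := exists_add_ball_prod_ball_eq_univ hdense hε
  have hΩm : NullMeasurableSet Ω := nullMeasurableSet_of_null_frontier hΩ₀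
  set S := Metric.thickening ε (frontier Ω)
  have hS : NullMeasurableSet S := Metric.isOpen_thickening.measurableSet.nullMeasurableSet
  have hcube : ∀ (x : EuclideanSpace ℝ (Fin m)) R, NullMeasurableSet (cube x R) := fun x R =>
    (measurableSet_cube x R).nullMeasurableSet
  refine ⟨2 * C, fun x R => ⟨?_, ?_⟩⟩ <;> rw [encard_modelSet_inter hinj]
  · have hshrink : cube (x + diagPoint m C) (R - 2 * C) ×ˢ (Ω \ S) -
        Metric.ball 0 C ×ˢ Metric.ball 0 ε ⊆ cube x R ×ˢ Ω := by
      rintro _ ⟨y, ⟨hy, hyΩ, hyS⟩, u, ⟨hu, huε⟩, rfl⟩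
      refine ⟨?_, (mem_iff_mem_of_dist_lt_of_notMem_thickening_frontier ?_ hyS).1 hyΩ⟩
      · simpa using closedBall_subset_cube (r := C) hy
          (show y.1 - u.1 ∈ _ by simpa using (mem_ball_zero_iff.1 hu).le)
      · simpa [dist_eq_norm] using huε
    calc _ ≤ ENNReal.ofReal (R - 2 * C) ^ m * volume (Ω \ S) := by
          gcongr
          exact (tsub_le_tsub_left hvol _).trans le_measure_sdiff
      _ = volume (cube (x + diagPoint m C) (R - 2 * C) ×ˢ (Ω \ S)) :=
          (volume_cube_prod _ _ _).symm
      _ ≤ _ := measure_le_covolume_mul_encard hU ((hcube _ _).prod (hΩm.diff hS)) hshrink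
  · have hgrow : cube x R ×ˢ Ω + Metric.ball 0 C ×ˢ Metric.ball 0 ε ⊆
        cube (x - diagPoint m C) (R + 2 * C) ×ˢ (Ω ∪ S) := by
      rintro _ ⟨y, ⟨hy, hyΩ⟩, u, ⟨hu, huε⟩, rfl⟩
      refine ⟨closedBall_subset_cube hy (by simpa using (mem_ball_zero_iff.1 hu).le), ?_⟩
      refine or_iff_not_imp_right.2 fun hyS =>
        (mem_iff_mem_of_dist_lt_of_notMem_thickening_frontier ?_ hyS).2 hyΩ
      simpa [dist_eq_norm] using huε
    calc _ ≤ volume (cube (x - diagPoint m C) (R + 2 * C) ×ˢ (Ω ∪ S)) :=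
          covolume_mul_encard_le_measure hU ((hcube _ _).prod (hΩm.union hS)) hgrow
      _ = ENNReal.ofReal (R + 2 * C) ^ m * volume (Ω ∪ S) := volume_cube_prod _ _ _
      _ ≤ _ := by
          gcongr
          exact (measure_union_le _ _).trans (by gcongr)

theorem hasDensity_modelSet
    (hinj : Set.InjOn Prod.fst (Γ : Set (EuclideanSpace ℝ (Fin m) × ℝ)))
    (hdense : Dense (Prod.snd '' (Γ : Set (EuclideanSpace ℝ (Fin m) × ℝ))))
    (hΩ : Bornology.IsBounded Ω) (hΩ₀ : volume (frontier Ω) = 0) :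
    HasDensity (modelSet Γ Ω) ((ZLattice.covolume Γ)⁻¹ * (volume Ω).toReal) := by
  have hV : 0 < ZLattice.covolume Γ := ZLattice.covolume_pos Γ volume
  have hfin : ∀ x R, (modelSet Γ Ω ∩ cube x R).Finite := fun x R =>
    finite_modelSet_inter hΩ (isBounded_cube x R)
  refine fun x => ⟨hfin x, ?_⟩
  have hlim := tendsto_div_ofReal_pow_of_forall_exists_bounds fun δ hδ =>
    (exists_bounds_covolume_mul_encard_modelSet_inter_cube hinj hdense hΩ hΩ₀
      (ENNReal.coe_pos.2 hδ)).imp fun C hC R => hC x R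
  refine (((ENNReal.tendsto_toReal hΩ.measure_lt_top.ne).comp hlim).const_mul
    (ZLattice.covolume Γ)⁻¹).congr' ?_
  filter_upwards [eventually_ge_atTop 0] with R hR
  have hcard : ((modelSet Γ Ω ∩ cube x R).encard : ℝ≥0∞).toReal =
      (modelSet Γ Ω ∩ cube x R).ncard := by
    rw [← (hfin x R).cast_ncard_eq]
    simp
  simp only [Function.comp_apply, ENNReal.toReal_div, ENNReal.toReal_mul, ENNReal.toReal_pow,
    ENNReal.toReal_ofReal hV.le, ENNReal.toReal_ofReal hR, hcard]
  field_simp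

end Density

section Fourier

variable {V E : Type*} [NormedAddCommGroup V] [InnerProductSpace ℝ V] [FiniteDimensional ℝ V]
  [MeasurableSpace V] [BorelSpace V] [NormedAddCommGroup E]

/-- The `L¹`-mass of `f` outside the ball of radius `r` around the origin; it is the price of
replacing a translate of `f` by its restriction to a set containing the translated ball. -/
noncomputable def tailMass (f : V → E) (r : ℝ) : ℝ≥0∞ :=
  ∫⁻ t in (Metric.closedBall 0 r)ᶜ, ‖f t‖ₑ

theorem lintegral_compl_comp_sub_le_tailMass (f : V → E) {x : V} {r : ℝ} {Q : Set V}
    (hQ : Metric.closedBall x r ⊆ Q) : ∫⁻ t in Qᶜ, ‖f (t - x)‖ₑ ≤ tailMass f r := by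
  have hpre : (fun t => t - x) ⁻¹' (Metric.closedBall 0 r)ᶜ = (Metric.closedBall x r)ᶜ := by
    ext t
    simp [dist_eq_norm]
  calc ∫⁻ t in Qᶜ, ‖f (t - x)‖ₑ ≤ ∫⁻ t in (Metric.closedBall x r)ᶜ, ‖f (t - x)‖ₑ :=
        lintegral_mono_set (Set.compl_subset_compl.2 hQ)
    _ = tailMass f r := by
      rw [← hpre]
      exact (measurePreserving_sub_right volume x).setLIntegral_comp_preimage_emb
        (MeasurableEquiv.subRight x).measurableEmbedding (fun t => ‖f t‖ₑ) _

theorem tendsto_tailMass {f : V → E} (hf : Integrable f) :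
    Tendsto (tailMass f) atTop (𝓝 0) := by
  have : IsFiniteMeasure (volume.withDensity fun t => ‖f t‖ₑ) :=
    isFiniteMeasure_withDensity hf.2.ne
  have htight := tendsto_measure_compl_closedBall_of_isTightMeasureSet
    (isTightMeasureSet_singleton (μ := volume.withDensity fun t => ‖f t‖ₑ)) (0 : V)
  simp only [Set.mem_singleton_iff, iSup_iSup_eq_left,
    withDensity_apply _ measurableSet_closedBall.compl] at htight
  exact htight

variable [NormedSpace ℂ E]

theorem enorm_fourier_comp_sub_right (f : V → E) (x ξ : V) :
    ‖𝓕 (fun t => f (t - x)) ξ‖ₑ = ‖𝓕 f ξ‖ₑ := by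
  have h : 𝓕 (fun t => f (t + -x)) = fun ξ => 𝐞 (innerₗ V (-x) ξ) • 𝓕 f ξ :=
    VectorFourier.fourierIntegral_comp_add_right 𝐞 volume (innerₗ V) f (-x)
  simp only [← sub_eq_add_neg] at h
  rw [h, ← ofReal_norm, Circle.norm_smul, ofReal_norm]

theorem enorm_fourier_le_indicator_add {f : V → E} (hf : Integrable f) {Q : Set V}
    (hQ : MeasurableSet Q) (ξ : V) :
    ‖𝓕 f ξ‖ₑ ≤ ‖𝓕 (Q.indicator f) ξ‖ₑ + ∫⁻ t in Qᶜ, ‖f t‖ₑ := by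
  have hintegrable : Integrable fun t => 𝐞 (-inner ℝ t ξ) • f t :=
    (Real.fourierIntegral_convergent_iff ξ).2 hf
  have hsplit : 𝓕 f ξ = 𝓕 (Q.indicator f) ξ +
      ∫ t in Qᶜ, 𝐞 (-inner ℝ t ξ) • f t := by
    simp only [Real.fourier_eq, ← Set.indicator_smul, ← integral_add_compl hQ hintegrable]
    rw [← integral_indicator hQ]
  calc ‖𝓕 f ξ‖ₑ ≤ ‖𝓕 (Q.indicator f) ξ‖ₑ +
        ‖∫ t in Qᶜ, 𝐞 (-inner ℝ t ξ) • f t‖ₑ := hsplit ▸ enorm_add_le _ _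
    _ ≤ ‖𝓕 (Q.indicator f) ξ‖ₑ + ∫⁻ t in Qᶜ, ‖f t‖ₑ := by
      gcongr
      refine (enorm_integral_le_lintegral_enorm _).trans_eq (lintegral_congr fun t => ?_)
      rw [← ofReal_norm, Circle.norm_smul, ofReal_norm]

theorem enorm_fourier_sub_tailMass_le {f : V → E} (hf : Integrable f) (ξ : V) {x : V} {r : ℝ}
    {Q : Set V} (hQ : MeasurableSet Q) (hxQ : Metric.closedBall x r ⊆ Q) :
    ‖𝓕 f ξ‖ₑ - tailMass f r ≤ ‖𝓕 (Q.indicator fun t => f (t - x)) ξ‖ₑ := by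
  refine tsub_le_iff_right.2 ?_
  rw [← enorm_fourier_comp_sub_right f x]
  exact (enorm_fourier_le_indicator_add (hf.comp_sub_right x) hQ ξ).trans
    (add_le_add_right (lintegral_compl_comp_sub_le_tailMass f hxQ) _)

/-- The plane wave of frequency `ξ` restricted to `Q`; pairing a function with it evaluates the
Fourier transform at `ξ` of the restriction of that function to `Q`, up to conjugation. -/
noncomputable def planeWaveOn (Q : Set V) (ξ : V) : V → ℂ :=
  Q.indicator fun t => (𝐞 (inner ℝ t ξ) : ℂ)

theorem enorm_integral_planeWaveOn_mul_conj (Q : Set V) (ξ : V) (f : V → ℂ) :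
    ‖∫ t, planeWaveOn Q ξ t * conj (f t)‖ₑ = ‖𝓕 (Q.indicator f) ξ‖ₑ := by
  have hconj : 𝓕 (Q.indicator f) ξ = conj (∫ t, planeWaveOn Q ξ t * conj (f t)) := by
    rw [Real.fourier_eq, ← integral_conj]
    refine integral_congr_ae (Eventually.of_forall fun t => ?_)
    by_cases ht : t ∈ Q <;> simp [planeWaveOn, ht, Circle.smul_def, AddChar.map_neg_eq_inv]
  rw [hconj, RCLike.enorm_conj]

theorem eLpNorm_planeWaveOn {Q : Set V} (hQ : MeasurableSet Q) (ξ : V) :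
    eLpNorm (planeWaveOn Q ξ) 2 volume ^ 2 = volume Q := by
  have henorm : ∀ t, ‖planeWaveOn Q ξ t‖ₑ = ‖Q.indicator (fun _ => (1 : ℂ)) t‖ₑ := fun t =>
    enorm_eq_iff_norm_eq.2 (by by_cases ht : t ∈ Q <;> simp [planeWaveOn, ht, Circle.norm_coe])
  rw [eLpNorm_congr_enorm_ae (Eventually.of_forall henorm),
    eLpNorm_indicator_const hQ two_ne_zero ENNReal.ofNat_ne_top, enorm_one, one_mul,
    ← ENNReal.rpow_natCast, ← ENNReal.rpow_mul]
  simp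

theorem memLp_planeWaveOn {Q : Set V} (hQ : MeasurableSet Q) (hQ' : volume Q ≠ ⊤) (ξ : V) :
    MemLp (planeWaveOn Q ξ) 2 volume := by
  refine ⟨(Continuous.aestronglyMeasurable (by fun_prop)).indicator hQ, ?_⟩
  refine (ENNReal.pow_lt_top_iff.1 ?_).resolve_right two_ne_zero
  rw [eLpNorm_planeWaveOn hQ]
  exact hQ'.lt_top

end Fourier

section Bessel

variable {m : ℕ} {K : Type*} {g : K → EuclideanSpace ℝ (Fin m) → ℂ} {B : ℝ≥0}
  {Λ : Set (EuclideanSpace ℝ (Fin m))} {D : ℝ}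

theorem IsBessel.comp_injective {ι κ : Type*} {u : ι → EuclideanSpace ℝ (Fin m) → ℂ}
    (hu : IsBessel u B) {e : κ → ι} (he : Function.Injective e) : IsBessel (fun j => u (e j)) B :=
  ⟨fun j => hu.1 (e j), fun f hf =>
    (ENNReal.tsum_comp_le_tsum_of_injective he _).trans (hu.2 f hf)⟩

theorem IsBessel.const_mul {ι : Type*} {u : ι → EuclideanSpace ℝ (Fin m) → ℂ}
    (hu : IsBessel u B) {w : ι → ℂ} {M : ℝ≥0} (hw : ∀ i, ‖w i‖₊ ≤ M) :
    IsBessel (fun i t => w i * u i t) (M ^ 2 * B) := by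
  refine ⟨fun i => (hu.1 i).const_mul _, fun f hf => ?_⟩
  have hpull : ∀ i, ∫ t, f t * conj (w i * u i t) = conj (w i) * ∫ t, f t * conj (u i t) :=
    fun i => by simp only [map_mul, mul_left_comm (f _), integral_const_mul]
  calc ∑' i, ‖∫ t, f t * conj (w i * u i t)‖ₑ ^ 2
      ≤ ∑' i, (M : ℝ≥0∞) ^ 2 * ‖∫ t, f t * conj (u i t)‖ₑ ^ 2 := by
        refine ENNReal.tsum_le_tsum fun i => ?_
        rw [hpull, enorm_mul, mul_pow, RCLike.enorm_conj]
        gcongr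
        exact ENNReal.coe_le_coe.2 (hw i)
    _ = (M : ℝ≥0∞) ^ 2 * ∑' i, ‖∫ t, f t * conj (u i t)‖ₑ ^ 2 := ENNReal.tsum_mul_left
    _ ≤ (M : ℝ≥0∞) ^ 2 * (B * eLpNorm f 2 volume ^ 2) := by
        gcongr
        exact hu.2 f hf
    _ = ((M ^ 2 * B : ℝ≥0) : ℝ≥0∞) * eLpNorm f 2 volume ^ 2 := by push_cast; ring

theorem IsBessel.encard_mul_tsum_le
    (hB : IsBessel (fun i : K × Λ => translate (i.2 : EuclideanSpace ℝ (Fin m)) (g i.1)) B)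
    (hg : ∀ k, Integrable (g k)) (ξ : EuclideanSpace ℝ (Fin m)) {r : ℝ}
    {Q : Set (EuclideanSpace ℝ (Fin m))} (hQ : MeasurableSet Q) (hQ' : volume Q ≠ ⊤)
    (hΛ : ∀ x ∈ Λ, Metric.closedBall x r ⊆ Q) :
    (Λ.encard : ℝ≥0∞) * ∑' k, (‖𝓕 (g k) ξ‖ₑ - tailMass (g k) r) ^ 2 ≤ B * volume Q := by
  calc (Λ.encard : ℝ≥0∞) * ∑' k, (‖𝓕 (g k) ξ‖ₑ - tailMass (g k) r) ^ 2
      = ∑' i : K × Λ, (‖𝓕 (g i.1) ξ‖ₑ - tailMass (g i.1) r) ^ 2 := by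
        rw [ENNReal.tsum_prod (f := fun k (_ : Λ) => (‖𝓕 (g k) ξ‖ₑ - tailMass (g k) r) ^ 2),
          ← ENNReal.tsum_mul_left]
        simp only [ENNReal.tsum_set_const]
    _ ≤ ∑' i : K × Λ, ‖∫ t, planeWaveOn Q ξ t * conj (translate i.2.1 (g i.1) t)‖ₑ ^ 2 := by
        refine ENNReal.tsum_le_tsum fun i => ?_
        rw [enorm_integral_planeWaveOn_mul_conj]
        gcongr
        exact enorm_fourier_sub_tailMass_le (hg i.1) ξ hQ (hΛ _ i.2.2)
    _ ≤ B * eLpNorm (planeWaveOn Q ξ) 2 volume ^ 2 := hB.2 _ (memLp_planeWaveOn hQ hQ' ξ)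
    _ = B * volume Q := by rw [eLpNorm_planeWaveOn hQ]

theorem HasDensity.tendsto_encard_div (hD : HasDensity Λ D) (x : EuclideanSpace ℝ (Fin m)) :
    Tendsto (fun R : ℝ => ((Λ ∩ cube x R).encard : ℝ≥0∞) / ENNReal.ofReal R ^ m) atTop
      (𝓝 (ENNReal.ofReal D)) := by
  refine (ENNReal.tendsto_ofReal (hD x).2).congr' ?_
  filter_upwards [eventually_gt_atTop 0] with R hR
  rw [ENNReal.ofReal_div_of_pos (by positivity), ENNReal.ofReal_natCast, ENNReal.ofReal_pow hR.le,
    ← ((hD x).1 R).cast_ncard_eq, ENat.toENNReal_coe]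

theorem HasDensity.ofReal_mul_le (hD : HasDensity Λ D) {b c : ℝ≥0∞} {C : ℝ}
    (h : ∀ R, ((Λ ∩ cube 0 R).encard : ℝ≥0∞) * c ≤ b * ENNReal.ofReal (R + C) ^ m) :
    ENNReal.ofReal D * c ≤ b := by
  rcases eq_or_ne (ENNReal.ofReal D) 0 with hD₀ | hD₀
  · simp [hD₀]
  have hleft := ENNReal.Tendsto.mul_const (hD.tendsto_encard_div 0) (b := c) (Or.inl hD₀)
  have hright := ENNReal.Tendsto.const_mul (tendsto_ofReal_add_const_pow_div m C) (a := b)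
    (Or.inl one_ne_zero)
  rw [mul_one] at hright
  refine le_of_tendsto_of_tendsto' hleft hright fun R => ?_
  rw [← ENNReal.mul_div_right_comm, ← mul_div_assoc]
  exact ENNReal.div_le_div_right (h R) _

theorem IsBessel.density_mul_tsum_le
    (hB : IsBessel (fun i : K × Λ => translate (i.2 : EuclideanSpace ℝ (Fin m)) (g i.1)) B)
    (hD : HasDensity Λ D) (hg : ∀ k, Integrable (g k)) (ξ : EuclideanSpace ℝ (Fin m)) :
    ENNReal.ofReal D * ∑' k, ‖𝓕 (g k) ξ‖ₑ ^ 2 ≤ B := by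
  have htail : ∀ r, ENNReal.ofReal D * ∑' k, (‖𝓕 (g k) ξ‖ₑ - tailMass (g k) r) ^ 2 ≤ B := by
    refine fun r => hD.ofReal_mul_le (C := 2 * r) fun R => ?_
    have hB' : IsBessel (fun i : K × ↥(Λ ∩ cube 0 R) =>
        translate (i.2 : EuclideanSpace ℝ (Fin m)) (g i.1)) B :=
      hB.comp_injective (e := Prod.map id (Set.inclusion Set.inter_subset_left))
        (Function.injective_id.prodMap (Set.inclusion_injective _))
    rw [← volume_cube (0 - diagPoint m r)]
    exact hB'.encard_mul_tsum_le hg ξ (measurableSet_cube _ _)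
      (isBounded_cube _ _).measure_lt_top.ne fun x hx => closedBall_subset_cube hx.2
  rw [← ENNReal.tsum_mul_left]
  refine ENNReal.summable.tsum_le_of_sum_le fun S => ?_
  rw [← Finset.mul_sum]
  have hlim : Tendsto (fun r => ∑ k ∈ S, (‖𝓕 (g k) ξ‖ₑ - tailMass (g k) r) ^ 2) atTop
      (𝓝 (∑ k ∈ S, ‖𝓕 (g k) ξ‖ₑ ^ 2)) := by
    refine tendsto_finsetSum S fun k _ => ENNReal.Tendsto.pow ?_
    simpa using ENNReal.Tendsto.sub tendsto_const_nhds (tendsto_tailMass (hg k))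
      (Or.inr ENNReal.zero_ne_top)
  refine le_of_tendsto' (ENNReal.Tendsto.const_mul hlim (Or.inr ENNReal.ofReal_ne_top))
    fun r => le_trans ?_ (htail r)
  gcongr
  exact ENNReal.sum_le_tsum S

end Bessel

theorem MemWiener.integrable {m : ℕ} {p : ℝ≥0∞} (hp : 1 ≤ p) {f : EuclideanSpace ℝ (Fin m) → ℂ}
    (hf : MemWiener p f) : Integrable f := by
  refine ⟨hf.1, ?_⟩
  have hcover : (⋃ k : Fin m → ℤ, cube (intPoint k) 1) = Set.univ :=
    Set.eq_univ_of_forall fun t => Set.mem_iUnion.2 ⟨_, mem_cube_floor t⟩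
  calc ∫⁻ t, ‖f t‖ₑ = ∫⁻ t in ⋃ k : Fin m → ℤ, cube (intPoint k) 1, ‖f t‖ₑ := by
        rw [hcover, Measure.restrict_univ]
    _ ≤ ∑' k : Fin m → ℤ, ∫⁻ t in cube (intPoint k) 1, ‖f t‖ₑ := lintegral_iUnion_le _ _
    _ ≤ ∑' k : Fin m → ℤ, eLpNorm ((cube (intPoint k) 1).indicator f) p volume := by
        refine ENNReal.tsum_le_tsum fun k => ?_
        have : IsProbabilityMeasure (volume.restrict (cube (intPoint k) 1)) :=
          ⟨by rw [Measure.restrict_apply_univ, volume_cube]; simp⟩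
        rw [eLpNorm_indicator_eq_eLpNorm_restrict (measurableSet_cube _ _),
          ← eLpNorm_one_eq_lintegral_enorm]
        exact eLpNorm_le_eLpNorm_of_exponent_le hp hf.1.restrict
    _ < ⊤ := hf.2

theorem ofReal_mul_mul_le_sq_mul {M B : ℝ≥0} {a c v : ℝ} {S : ℝ≥0∞} (hc : 0 ≤ c)
    (ha : a ≤ (M : ℝ) ^ 2 * v) (hS : ENNReal.ofReal (c * v) * S ≤ B) :
    ENNReal.ofReal (c * a) * S ≤ ((M ^ 2 * B : ℝ≥0) : ℝ≥0∞) := by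
  calc ENNReal.ofReal (c * a) * S ≤ ENNReal.ofReal ((M : ℝ) ^ 2 * (c * v)) * S := by
        gcongr ENNReal.ofReal ?_ * _
        exact (mul_le_mul_of_nonneg_left ha hc).trans_eq (mul_left_comm _ _ _)
    _ = ((M ^ 2 : ℝ≥0) : ℝ≥0∞) * (ENNReal.ofReal (c * v) * S) := by
        rw [ENNReal.ofReal_mul (by positivity), mul_assoc, ← NNReal.coe_pow,
          ENNReal.ofReal_coe_nnreal]
    _ ≤ ((M ^ 2 * B : ℝ≥0) : ℝ≥0∞) := by
        rw [ENNReal.coe_mul]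
        gcongr

section Weight

variable {ψ : ℝ → ℝ} {Ω : Set ℝ}

theorem nnnorm_le_supNorm (hψ : Continuous ψ) (hsupp : HasCompactSupport ψ) (s : ℝ) :
    ‖ψ s‖₊ ≤ supNorm ψ := by
  obtain ⟨C, hC⟩ := hψ.bounded_above_of_compact_support hsupp
  exact le_ciSup (f := fun s => ‖ψ s‖₊)
    ⟨C.toNNReal, Set.forall_mem_range.2 fun t => NNReal.le_toNNReal_of_coe_le (hC t)⟩ s

theorem nnnorm_weight_le {m : ℕ} (Γ : Submodule ℤ (EuclideanSpace ℝ (Fin m) × ℝ)) (Ω : Set ℝ)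
    {M : ℝ≥0} (hM : ∀ s, ‖ψ s‖₊ ≤ M) (x : EuclideanSpace ℝ (Fin m)) :
    ‖weight Γ Ω ψ x‖₊ ≤ M := by
  unfold weight
  split_ifs
  · exact hM _
  · simp

theorem re_fourier_ofReal_sq_zero_le {M : ℝ≥0} (hM : ∀ s, ‖ψ s‖₊ ≤ M)
    (hsupp : Function.support ψ ⊆ Ω) (hΩ : NullMeasurableSet Ω) (hΩ' : volume Ω ≠ ⊤) :
    (𝓕 (fun s : ℝ => (ψ s : ℂ) ^ 2) 0).re ≤ (M : ℝ) ^ 2 * (volume Ω).toReal := by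
  have hfourier : 𝓕 (fun s : ℝ => (ψ s : ℂ) ^ 2) 0 = ((∫ s, ψ s ^ 2 : ℝ) : ℂ) := by
    rw [Real.fourier_eq', ← integral_complex_ofReal]
    simp
  have hle : ∀ s, ψ s ^ 2 ≤ Ω.indicator (fun _ => (M : ℝ) ^ 2) s := fun s => by
    by_cases hs : s ∈ Ω
    · simpa [hs] using pow_le_pow_left₀ (norm_nonneg _) (hM s) 2
    · simp [hs, Function.notMem_support.1 fun h => hs (hsupp h)]
  rw [hfourier, Complex.ofReal_re]
  calc ∫ s, ψ s ^ 2 ≤ ∫ s, Ω.indicator (fun _ => (M : ℝ) ^ 2) s :=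
        integral_mono_of_nonneg (Eventually.of_forall fun s => sq_nonneg _)
          ((integrableOn_const hΩ').integrable_indicator₀ hΩ) (Eventually.of_forall hle)
    _ = (M : ℝ) ^ 2 * (volume Ω).toReal := by
        rw [integral_indicator₀ hΩ, setIntegral_const, smul_eq_mul, mul_comm]
        rfl

end Weight

end ModelSet

theorem proposition4p3_general {m : ℕ} (Γ : Submodule ℤ (EuclideanSpace ℝ (Fin m) × ℝ))
    [DiscreteTopology Γ] [IsZLattice ℝ Γ]
    (hinj : Set.InjOn Prod.fst (Γ : Set (EuclideanSpace ℝ (Fin m) × ℝ)))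
    (hdense : Dense (Prod.snd '' (Γ : Set (EuclideanSpace ℝ (Fin m) × ℝ))))
    (Ω : Set ℝ) (hΩ : Bornology.IsBounded Ω) (hΩ₀ : volume (frontier Ω) = 0)
    {K : Type*} (g : K → EuclideanSpace ℝ (Fin m) → ℂ) (hg : ∀ k, Integrable (g k)) (B : ℝ≥0)
    (hB : ModelSet.IsBessel
      (fun i : K × ModelSet.modelSet Γ Ω =>
        ModelSet.translate (i.2 : EuclideanSpace ℝ (Fin m)) (g i.1)) B) :
    (∀ ψ : ℝ → ℝ, Continuous ψ → Function.support ψ ⊆ Ω →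
      ModelSet.IsBessel
        (fun (i : K × ModelSet.modelSet Γ Ω) t =>
          (ModelSet.weight Γ Ω ψ i.2 : ℂ) *
            ModelSet.translate (i.2 : EuclideanSpace ℝ (Fin m)) (g i.1) t)
        (ModelSet.supNorm ψ ^ 2 * B) ∧
      ∀ t : EuclideanSpace ℝ (Fin m),
        ENNReal.ofReal ((ZLattice.covolume Γ)⁻¹ * (𝓕 (fun s : ℝ => ((ψ s : ℂ) ^ 2)) 0).re) *
            ∑' k, ‖𝓕 (g k) t‖ₑ ^ 2
          ≤ ((ModelSet.supNorm ψ ^ 2 * B : ℝ≥0) : ℝ≥0∞)) ∧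
    ModelSet.HasDensity (ModelSet.modelSet Γ Ω)
      ((ZLattice.covolume Γ)⁻¹ * (volume Ω).toReal) ∧
    ∀ t : EuclideanSpace ℝ (Fin m),
      ENNReal.ofReal ((ZLattice.covolume Γ)⁻¹ * (volume Ω).toReal) * ∑' k, ‖𝓕 (g k) t‖ₑ ^ 2
        ≤ (B : ℝ≥0∞) := by
  have hdensity := ModelSet.hasDensity_modelSet hinj hdense hΩ hΩ₀
  have hbound := hB.density_mul_tsum_le hdensity hg
  refine ⟨fun ψ hψ hsupp => ?_, hdensity, hbound⟩
  have hcompact : HasCompactSupport ψ :=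
    Metric.isCompact_of_isClosed_isBounded (isClosed_tsupport ψ)
      (hΩ.closure.subset (closure_mono hsupp))
  have hsup := ModelSet.nnnorm_le_supNorm hψ hcompact
  have hweight : ∀ i : K × ModelSet.modelSet Γ Ω,
      ‖(ModelSet.weight Γ Ω ψ i.2 : ℂ)‖₊ ≤ ModelSet.supNorm ψ := fun i => by
    rw [Complex.nnnorm_real]
    exact ModelSet.nnnorm_weight_le Γ Ω hsup i.2
  have hfourier := ModelSet.re_fourier_ofReal_sq_zero_le hsup hsupp
    (nullMeasurableSet_of_null_frontier hΩ₀) hΩ.measure_lt_top.ne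
  have hV : 0 ≤ (ZLattice.covolume Γ)⁻¹ := inv_nonneg.2 (ZLattice.covolume_pos Γ volume).le
  exact ⟨hB.const_mul hweight, fun t =>
    ModelSet.ofReal_mul_mul_le_sq_mul hV hfourier (hbound t)⟩

theorem proposition4p3 {m : ℕ} (Γ : Submodule ℤ (EuclideanSpace ℝ (Fin m) × ℝ))
    [DiscreteTopology Γ] [IsZLattice ℝ Γ] (hΓ : ModelSet.IsCutProject Γ)
    (Ω : Set ℝ) (hΩ : ModelSet.IsIntervalWindow Ω) (hsymm : ∀ s, s ∈ Ω → -s ∈ Ω)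
    {K : Type*} [Countable K] (g : K → EuclideanSpace ℝ (Fin m) → ℂ)
    (hg : ∀ k, ModelSet.MemWiener 2 (g k)) (B : ℝ≥0)
    (hB : ModelSet.IsBessel
      (fun i : K × ModelSet.modelSet Γ Ω => ModelSet.translate (i.2 : EuclideanSpace ℝ (Fin m)) (g i.1))
      B) :
    (∀ ψ : ℝ → ℝ, ModelSet.IsSmoothOn Ω ψ → (∀ s, 0 ≤ ψ s) →
      ModelSet.IsBessel
        (fun (i : K × ModelSet.modelSet Γ Ω) t =>
          (ModelSet.weight Γ Ω ψ i.2 : ℂ) *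
            ModelSet.translate (i.2 : EuclideanSpace ℝ (Fin m)) (g i.1) t)
        (ModelSet.supNorm ψ ^ 2 * B) ∧
      ∀ᵐ t : EuclideanSpace ℝ (Fin m),
        ENNReal.ofReal ((ZLattice.covolume Γ)⁻¹ * (𝓕 (fun s : ℝ => ((ψ s : ℂ) ^ 2)) 0).re) *
            ∑' k, ‖𝓕 (g k) t‖ₑ ^ 2
          ≤ ((ModelSet.supNorm ψ ^ 2 * B : ℝ≥0) : ℝ≥0∞)) ∧
    ∃ D : ℝ, ModelSet.HasDensity (ModelSet.modelSet Γ Ω) D ∧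
      D = (ZLattice.covolume Γ)⁻¹ * (volume Ω).toReal ∧
      ∀ᵐ t : EuclideanSpace ℝ (Fin m),
        ENNReal.ofReal D * ∑' k, ‖𝓕 (g k) t‖ₑ ^ 2 ≤ (B : ℝ≥0∞) := by
  obtain ⟨hweighted, hdensity, hbound⟩ := proposition4p3_general Γ hΓ.injOn_fst hΓ.dense_snd Ω
    hΩ.isCompact.isBounded hΩ.volume_frontier g (fun k => (hg k).integrable one_le_two) B hB
  exact ⟨fun ψ hψ _ => (hweighted ψ hψ.1.continuous ((subset_tsupport ψ).trans hψ.2)).imp_right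
    Eventually.of_forall, _, hdensity, rfl, Eventually.of_forall hbound⟩
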